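/- Let $-1<q<1$. For a complex Hilbert space $H$ let $H_q^{\otimes n}$ be the Hilbert space obtained from the algebraic tensor power of $H$ with the $q$-deformed inner product $$\langle v_1\otimes\cdots\otimes v_n,\;w_1\otimes\cdots\otimes w_n\rangle_q=\sum_{\sigma\in S_n}q^{\mathrm{inv}(\sigma)}\prod_{i=1}^n\langle v_i,w_{\sigma(i)}\rangle ,$$ where $\mathrm{inv}(\sigma)$ is the number of inversions of $\sigma$, and let $\mathcal F_q(H)=\bigoplus_{n\ge 0}H_q^{\otimes n}$ (Hilbert space direct sum, $H_q^{\otimes 0}=\mathbb C$) be the $q$-Fock space. For $v\in H$ let $a_q^*(v)\in B(\mathcal F_q(H))$ be the $q$-creation operator $x\mapsto v\otimes x$. For a closed subspace $L\subseteq H$ let $\mathcal T_q(L,H)$ be the unital $C^*$-subalgebra of $B(\mathcal F_q(H))$ generated by $\{a_q^*(v):v\in L\}$, and put $\mathcal T_q(H)=\mathcal T_q(H,H)$, the $q$-Toeplitz algebra of $H$. Theorem. Let $K$ and $H$ be complex Hilbert spaces and let $\iota:K\to H$ be an inclusion (a linear isometry, by which $K$ is identified with the closed subspace $\iota(K)$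 of $H$). Let $\mathcal F_q(\iota):\mathcal F_q(K)\to\mathcal F_q(H)$ be the isometry $v_1\otimes\cdots\otimes v_n\mapsto \iota v_1\otimes\cdots\otimes\iota v_n$. Then the compression $$\mathcal T_q(\iota^*)(x)=\mathcal F_q(\iota)^*\,x\,\mathcal F_q(\iota)$$ defines a $*$-homomorphism $\mathcal T_q(\iota^*):\mathcal T_q(K,H)\to\mathcal T_q(K)$, where $\mathcal T_q(K,H)=\mathcal T_q(\iota(K),H)$, and this $*$-homomorphism is injective. -/

import Mathlib

namespace QFock
open scoped TensorProduct InnerProductSpace ComplexConjugate ComplexOrder Matrix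

/-- The number of inversions of a permutation of `{0, …, n-1}`. -/
def inversions {n : ℕ} (σ : Equiv.Perm (Fin n)) : ℕ :=
  (Finset.univ.filter fun p : Fin n × Fin n => p.1 < p.2 ∧ σ p.2 < σ p.1).card

theorem inversions_inv {n : ℕ} (σ : Equiv.Perm (Fin n)) :
    inversions σ⁻¹ = inversions σ := by
  unfold inversions
  refine Finset.card_nbij' (fun p => (σ⁻¹ p.2, σ⁻¹ p.1)) (fun p => (σ p.2, σ p.1)) ?_ ?_ ?_ ?_ <;>
    simp +contextual [Set.MapsTo, Set.LeftInvOn]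

/-- Inversions of `τ * σ⁻¹` are the pairs on which `σ` and `τ` disagree. -/
theorem inversions_mul_inv {n : ℕ} (σ τ : Equiv.Perm (Fin n)) :
    inversions (τ * σ⁻¹) = (Finset.univ.filter fun p : Fin n × Fin n =>
      p.1 < p.2 ∧ ¬ (σ p.2 < σ p.1 ↔ τ p.2 < τ p.1)).card := by
  unfold inversions
  refine Finset.card_nbij'
    (fun p => if σ⁻¹ p.1 < σ⁻¹ p.2 then (σ⁻¹ p.1, σ⁻¹ p.2) else (σ⁻¹ p.2, σ⁻¹ p.1))
    (fun p => if σ p.1 < σ p.2 then (σ p.1, σ p.2) else (σ p.2, σ p.1)) ?_ ?_ ?_ ?_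
  · rintro ⟨i, j⟩ h
    replace h := (Finset.mem_filter.1 (Finset.mem_coe.1 h)).2
    obtain ⟨a, rfl⟩ := σ.surjective i
    obtain ⟨b, rfl⟩ := σ.surjective j
    simp only [Finset.coe_filter, Finset.mem_univ, true_and, Set.mem_ofPred_eq,
      Equiv.Perm.mul_apply, Equiv.Perm.inv_def, Equiv.symm_apply_apply] at h ⊢
    by_cases hab : a < b
    · simp [hab, h.2, h.1.le]
    · have hne : a ≠ b := by rintro rfl; exact lt_irrefl _ h.1
      have : b < a := lt_of_le_of_ne (not_lt.1 hab) hne.symm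
      simp [hab, this, h.1, h.2.le]
  · rintro ⟨a, b⟩ h
    simp only [Finset.coe_filter, Finset.mem_univ, true_and, Set.mem_ofPred_eq] at h ⊢
    have hs : σ a ≠ σ b := fun e => h.1.ne (σ.injective e)
    have ht : τ a ≠ τ b := fun e => h.1.ne (τ.injective e)
    rcases lt_or_gt_of_ne hs with h1 | h1 <;> rcases lt_or_gt_of_ne ht with h2 | h2 <;>
      simp_all [not_lt_of_gt]
  · rintro ⟨i, j⟩ h
    replace h := (Finset.mem_filter.1 (Finset.mem_coe.1 h)).2
    obtain ⟨a, rfl⟩ := σ.surjective i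
    obtain ⟨b, rfl⟩ := σ.surjective j
    simp only [Finset.coe_filter, Finset.mem_univ, true_and, Set.mem_ofPred_eq,
      Equiv.Perm.mul_apply, Equiv.Perm.inv_def, Equiv.symm_apply_apply] at h ⊢
    by_cases hab : a < b
    · simp [hab, h.1]
    · simp [hab, not_lt.2 h.1.le]
  · rintro ⟨a, b⟩ h
    simp only [Finset.coe_filter, Finset.mem_univ, true_and, Set.mem_ofPred_eq] at h ⊢
    by_cases hab : σ a < σ b
    · simp [hab, h.1]
    · simp [hab, not_lt.2 h.1.le]

/-- The permutation of `{0, …, n}` sending `0` to `k` and acting like `σ` on the rest. -/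
def consPerm {n : ℕ} (p : Fin (n + 1) × Equiv.Perm (Fin n)) : Equiv.Perm (Fin (n + 1)) :=
  ((finSuccEquiv' 0).trans (Equiv.optionCongr p.2)).trans (finSuccEquiv' p.1).symm

@[simp] theorem consPerm_zero {n : ℕ} (p : Fin (n + 1) × Equiv.Perm (Fin n)) :
    consPerm p 0 = p.1 := by
  simp [consPerm]

@[simp] theorem consPerm_succ {n : ℕ} (p : Fin (n + 1) × Equiv.Perm (Fin n)) (i : Fin n) :
    consPerm p i.succ = p.1.succAbove (p.2 i) := by
  have : finSuccEquiv' (0 : Fin (n + 1)) i.succ = some i := by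
    rw [← Fin.zero_succAbove]; exact finSuccEquiv'_succAbove 0 i
  simp [consPerm, this]

theorem consPerm_bijective {n : ℕ} : Function.Bijective (consPerm (n := n)) := by
  rw [Fintype.bijective_iff_injective_and_card]
  constructor
  · rintro ⟨k, σ⟩ ⟨l, τ⟩ h
    have h0 : k = l := by simpa using congrArg (fun π => π 0) h
    subst h0
    congr 1
    ext1 i
    simpa using congrArg (fun π => π i.succ) h
  · simp [Fintype.card_perm, Nat.factorial_succ]

theorem inversions_consPerm {n : ℕ} (p : Fin (n + 1) × Equiv.Perm (Fin n)) :
    inversions (consPerm p) = p.1 + inversions p.2 := by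
  obtain ⟨k, σ⟩ := p
  have key : ∀ {m : ℕ} (π : Equiv.Perm (Fin m)), inversions π =
      ∑ i, ∑ j, if i < j ∧ π j < π i then 1 else 0 := by
    intro m π
    rw [inversions, Finset.card_filter, Fintype.sum_prod_type]
  rw [key, key, Fin.sum_univ_succ]
  simp only [Fin.sum_univ_succ, consPerm_zero, consPerm_succ]
  simp only [lt_self_iff_false, false_and, if_false, zero_add, Fin.succ_pos, true_and,
    Fin.not_lt_zero, Fin.succ_lt_succ_iff, Fin.succAbove_lt_succAbove_iff]
  congr 1
  rw [Equiv.sum_comp σ (fun j => if k.succAbove j < k then 1 else 0), ← Finset.card_filter]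
  simp only [Fin.succAbove_lt_iff_castSucc_lt]
  have : (Finset.univ.filter fun j : Fin n => j.castSucc < k) =
      Finset.univ.filter fun j : Fin n => (j : ℕ) < k := by
    ext j; simp [Fin.lt_def]
  rw [this, Fin.card_filter_val_lt]
  omega

noncomputable section Form

variable {H : Type*} [NormedAddCommGroup H] [InnerProductSpace ℂ H]

/-- For fixed `v`, the multilinear functional
`w ↦ ∑ σ, q ^ inversions σ * ∏ i, ⟪v i, w (σ i)⟫`. -/
def pairing (q : ℝ) {n : ℕ} (v : Fin n → H) : MultilinearMap ℂ (fun _ : Fin n => H) ℂ :=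
  ∑ σ : Equiv.Perm (Fin n), ((q : ℂ) ^ inversions σ) •
    ((MultilinearMap.mkPiAlgebra ℂ (Fin n) ℂ).compLinearMap
      (fun i => innerₛₗ ℂ (v i))).domDomCongr σ

theorem pairing_apply (q : ℝ) {n : ℕ} (v w : Fin n → H) :
    pairing q v w = ∑ σ : Equiv.Perm (Fin n), (q : ℂ) ^ inversions σ * ∏ i, ⟪v i, w (σ i)⟫_ℂ := by
  simp [pairing]

/-- The functional `x ↦ conj ⟪v₀ ⊗ ⋯ ⊗ vₙ₋₁, x⟫_q`, as a multilinear map of `v`. -/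
def conjPairing (q : ℝ) (n : ℕ) :
    MultilinearMap ℂ (fun _ : Fin n => H) ((⨂[ℂ] _ : Fin n, H) →ₗ⋆[ℂ] ℂ) where
  toFun v := (starLinearEquiv ℂ (A := ℂ)).toLinearMap.comp (PiTensorProduct.lift (pairing q v))
  map_update_add' v i a b := by
    rename_i inst
    obtain rfl : inst = instDecidableEqFin n := Subsingleton.elim _ _
    have : pairing q (Function.update v i (a + b)) =
        pairing q (Function.update v i a) + pairing q (Function.update v i b) := by
      ext w
      simp only [pairing_apply, add_apply, ← Finset.sum_add_distrib, ← mul_add]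
      refine Finset.sum_congr rfl fun σ _ => ?_
      simp only [Function.apply_update (fun j (x : H) => ⟪x, w (σ j)⟫_ℂ),
        Finset.prod_update_of_mem (Finset.mem_univ i), inner_add_left, add_mul]
    ext x
    simp [this]
  map_update_smul' v i c a := by
    rename_i inst
    obtain rfl : inst = instDecidableEqFin n := Subsingleton.elim _ _
    have : pairing q (Function.update v i (c • a)) =
        conj c • pairing q (Function.update v i a) := by
      ext w
      simp only [pairing_apply, smul_apply, smul_eq_mul, Finset.mul_sum]
      refine Finset.sum_congr rfl fun σ _ => ?_
      simp only [Function.apply_update (fun j (x : H) => ⟪x, w (σ j)⟫_ℂ),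
        Finset.prod_update_of_mem (Finset.mem_univ i), inner_smul_left]
      ring
    ext x
    simp [this]

/-- The `q`-deformed sesquilinear form on the algebraic tensor power `H^{⊗n}`
(conjugate linear in the first variable), characterised by `qForm_tprod`. -/
def qForm (q : ℝ) (n : ℕ) (x y : ⨂[ℂ] _ : Fin n, H) : ℂ :=
  conj (PiTensorProduct.lift (conjPairing q n) x y)

/-- `⟪v₁ ⊗ ⋯ ⊗ vₙ, w₁ ⊗ ⋯ ⊗ wₙ⟫_q = ∑ σ, q ^ inversions σ * ∏ i, ⟪vᵢ, w_{σ i}⟫`. -/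
theorem qForm_tprod (q : ℝ) {n : ℕ} (v w : Fin n → H) :
    qForm q n (PiTensorProduct.tprod ℂ v) (PiTensorProduct.tprod ℂ w) =
      ∑ σ : Equiv.Perm (Fin n), (q : ℂ) ^ inversions σ * ∏ i, ⟪v i, w (σ i)⟫_ℂ := by
  simp [qForm, conjPairing, ← pairing_apply]

theorem qForm_add_left (q : ℝ) {n : ℕ} (x x' y : ⨂[ℂ] _ : Fin n, H) :
    qForm q n (x + x') y = qForm q n x y + qForm q n x' y := by
  simp [qForm]

theorem qForm_smul_left (q : ℝ) {n : ℕ} (c : ℂ) (x y : ⨂[ℂ] _ : Fin n, H) :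
    qForm q n (c • x) y = conj c * qForm q n x y := by
  simp [qForm]

theorem qForm_add_right (q : ℝ) {n : ℕ} (x y y' : ⨂[ℂ] _ : Fin n, H) :
    qForm q n x (y + y') = qForm q n x y + qForm q n x y' := by
  simp [qForm]

theorem qForm_smul_right (q : ℝ) {n : ℕ} (c : ℂ) (x y : ⨂[ℂ] _ : Fin n, H) :
    qForm q n x (c • y) = c * qForm q n x y := by
  simp [qForm]

theorem qForm_sum_left (q : ℝ) {n : ℕ} {α : Type*} (s : Finset α)
    (f : α → ⨂[ℂ] _ : Fin n, H) (y : ⨂[ℂ] _ : Fin n, H) :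
    qForm q n (∑ a ∈ s, f a) y = ∑ a ∈ s, qForm q n (f a) y := by
  simp [qForm]

theorem qForm_sum_right (q : ℝ) {n : ℕ} {α : Type*} (s : Finset α)
    (x : ⨂[ℂ] _ : Fin n, H) (f : α → ⨂[ℂ] _ : Fin n, H) :
    qForm q n x (∑ a ∈ s, f a) = ∑ a ∈ s, qForm q n x (f a) := by
  simp [qForm]

theorem qForm_conj_symm (q : ℝ) {n : ℕ} (x y : ⨂[ℂ] _ : Fin n, H) :
    conj (qForm q n y x) = qForm q n x y := by
  induction x using PiTensorProduct.induction_on with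
  | add x x' hx hx' => rw [qForm_add_left, qForm_add_right, map_add, hx, hx']
  | smul_tprod c v =>
    induction y using PiTensorProduct.induction_on with
    | add y y' hy hy' => rw [qForm_add_left, qForm_add_right, map_add, hy, hy']
    | smul_tprod d w =>
      simp only [qForm_smul_left, qForm_smul_right, qForm_tprod, map_mul, map_sum, map_prod,
        map_pow, Complex.conj_ofReal, inner_conj_symm, Complex.conj_conj]
      rw [← Equiv.sum_comp (Equiv.inv (Equiv.Perm (Fin n)))]
      change conj c * (d * ∑ σ : Equiv.Perm (Fin n), (q : ℂ) ^ inversions σ⁻¹ *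
        ∏ i, ⟪v (σ⁻¹ i), w i⟫_ℂ) = _
      have : ∀ σ : Equiv.Perm (Fin n), ∏ i, ⟪v (σ⁻¹ i), w i⟫_ℂ = ∏ i, ⟪v i, w (σ i)⟫_ℂ := by
        intro σ
        rw [← Equiv.prod_comp σ (fun i => ⟪v (σ⁻¹ i), w i⟫_ℂ)]
        exact Finset.prod_congr rfl fun i _ => by
          rw [show σ⁻¹ (σ i) = i from σ.symm_apply_apply i]
      simp only [this, inversions_inv]
      ring

/-- The matrix `q ^ inversions (τ * σ⁻¹)` indexed by permutations is positive semidefinite. -/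
theorem posSemidef_pow_inversions {q : ℝ} (hq : |q| ≤ 1) (n : ℕ) :
    (Matrix.of fun σ τ : Equiv.Perm (Fin n) =>
      ((q : ℂ) ^ inversions (τ * σ⁻¹))).PosSemidef := by
  have h2 : (Matrix.of fun b c : Prop => open scoped Classical in
      if (b ↔ c) then (1 : ℂ) else q).PosSemidef := by
    classical
    let u : Prop → EuclideanSpace ℂ (Fin 2) := fun b =>
      if b then !₂[1, 0] else !₂[(q : ℂ), (Real.sqrt (1 - q ^ 2) : ℂ)]
    have hs : 0 ≤ 1 - q ^ 2 := by nlinarith [abs_le.1 hq, sq_abs q, abs_nonneg q]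
    have hs' : ((Real.sqrt (1 - q ^ 2) : ℂ)) * (Real.sqrt (1 - q ^ 2) : ℂ) = 1 - (q : ℂ) ^ 2 := by
      rw [← Complex.ofReal_mul, Real.mul_self_sqrt hs]; push_cast; ring
    have e : (Matrix.of fun b c : Prop => if (b ↔ c) then (1 : ℂ) else q) = Matrix.gram ℂ u := by
      ext b c
      by_cases hb : b <;> by_cases hc : c <;>
        simp [u, hb, hc, Matrix.gram_apply, PiLp.inner_apply, Fin.sum_univ_two, hs',
          -inner_self_eq_norm_sq_to_K]
      ring
    rw [e]
    exact Matrix.posSemidef_gram ℂ u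
  have hprod : ∀ s : Finset (Fin n × Fin n),
      (Matrix.of fun σ τ : Equiv.Perm (Fin n) => ∏ p ∈ s,
        if (σ p.2 < σ p.1 ↔ τ p.2 < τ p.1) then (1 : ℂ) else q).PosSemidef := by
    intro s
    classical
    induction s using Finset.induction_on with
    | empty =>
      simpa [Matrix.gram] using Matrix.posSemidef_gram ℂ (fun _ : Equiv.Perm (Fin n) => (1 : ℂ))
    | insert p s hp ih =>
      have := (h2.submatrix (fun σ : Equiv.Perm (Fin n) => σ p.2 < σ p.1)).hadamard ih
      refine (congrArg Matrix.PosSemidef ?_).mp this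
      ext σ τ
      simp [Finset.prod_insert hp]
  refine (congrArg Matrix.PosSemidef ?_).mp (hprod (Finset.univ.filter fun p => p.1 < p.2))
  ext σ τ
  rw [Matrix.of_apply, Matrix.of_apply, inversions_mul_inv, Finset.prod_ite]
  simp [Finset.filter_filter]

theorem posSemidef_prod_inner {n : ℕ} {α : Type*} [Finite α] (v : α → Fin n → H) :
    (Matrix.of fun a b : α => ∏ i, ⟪v a i, v b i⟫_ℂ).PosSemidef := by
  have hprod : ∀ s : Finset (Fin n),
      (Matrix.of fun a b : α => ∏ i ∈ s, ⟪v a i, v b i⟫_ℂ).PosSemidef := by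
    intro s
    classical
    induction s using Finset.induction_on with
    | empty =>
      simpa [Matrix.gram] using Matrix.posSemidef_gram ℂ (fun _ : α => (1 : ℂ))
    | insert i s hi ih =>
      have := (Matrix.posSemidef_gram ℂ (fun a => v a i)).hadamard ih
      refine (congrArg Matrix.PosSemidef ?_).mp this
      ext a b
      simp [Finset.prod_insert hi, Matrix.gram_apply]
  exact hprod Finset.univ

theorem qForm_self_nonneg {q : ℝ} (hq : |q| ≤ 1) {n : ℕ} (x : ⨂[ℂ] _ : Fin n, H) :
    0 ≤ (qForm q n x x).re := by
  obtain ⟨m, c, g, rfl⟩ := Submodule.mem_span_set'.1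
    (show x ∈ Submodule.span ℂ (Set.range (PiTensorProduct.tprod ℂ (s := fun _ : Fin n => H))) by
      rw [PiTensorProduct.span_tprod_eq_top]; trivial)
  choose v hv using fun a => (g a).2
  simp only [← hv]
  have hA := (posSemidef_pow_inversions hq n).submatrix
    (fun p : Fin m × Equiv.Perm (Fin n) => p.2)
  have hB := posSemidef_prod_inner (fun (p : Fin m × Equiv.Perm (Fin n)) i => v p.1 (p.2 i))
  have hN := (hA.hadamard hB).dotProduct_mulVec_nonneg (fun p => c p.1)
  have key : ∀ a b : Fin m, ∑ σ : Equiv.Perm (Fin n), ∑ τ : Equiv.Perm (Fin n),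
      ((q : ℂ) ^ inversions (τ * σ⁻¹) * ∏ i, ⟪v a (σ i), v b (τ i)⟫_ℂ) =
      (n.factorial : ℂ) * qForm q n (PiTensorProduct.tprod ℂ (v a))
        (PiTensorProduct.tprod ℂ (v b)) := by
    intro a b
    have : ∀ σ : Equiv.Perm (Fin n), ∑ τ : Equiv.Perm (Fin n),
        ((q : ℂ) ^ inversions (τ * σ⁻¹) * ∏ i, ⟪v a (σ i), v b (τ i)⟫_ℂ) =
        qForm q n (PiTensorProduct.tprod ℂ (v a)) (PiTensorProduct.tprod ℂ (v b)) := by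
      intro σ
      rw [qForm_tprod, ← Equiv.sum_comp (Equiv.mulRight σ)]
      refine Finset.sum_congr rfl fun π _ => ?_
      rw [← Equiv.prod_comp σ (fun i => ⟪v a i, v b (π i)⟫_ℂ)]
      simp
    simp [this, Fintype.card_perm]
  have hsum : (n.factorial : ℂ) * qForm q n (∑ a, c a • PiTensorProduct.tprod ℂ (v a))
      (∑ a, c a • PiTensorProduct.tprod ℂ (v a)) =
      star (fun p : Fin m × Equiv.Perm (Fin n) => c p.1) ⬝ᵥ
        (Matrix.hadamard ((Matrix.of fun σ τ : Equiv.Perm (Fin n) =>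
          ((q : ℂ) ^ inversions (τ * σ⁻¹))).submatrix
            (fun p : Fin m × Equiv.Perm (Fin n) => p.2)
            (fun p : Fin m × Equiv.Perm (Fin n) => p.2))
          (Matrix.of fun a b : Fin m × Equiv.Perm (Fin n) =>
            ∏ i, ⟪v a.1 (a.2 i), v b.1 (b.2 i)⟫_ℂ)).mulVec
          (fun p : Fin m × Equiv.Perm (Fin n) => c p.1) := by
    simp only [qForm_sum_left, qForm_sum_right, qForm_smul_left, qForm_smul_right,
      dotProduct, Matrix.mulVec, Fintype.sum_prod_type, Finset.mul_sum, Matrix.hadamard_apply,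
      Matrix.submatrix_apply, Matrix.of_apply, Pi.star_apply]
    rw [Finset.sum_comm]
    refine Finset.sum_congr rfl fun a _ => ?_
    rw [Finset.sum_comm]
    refine Finset.sum_congr rfl fun b _ => ?_
    have := key a b
    calc _ = conj (c a) * c b * ((n.factorial : ℂ) * qForm q n (PiTensorProduct.tprod ℂ (v a))
        (PiTensorProduct.tprod ℂ (v b))) := by ring
      _ = _ := by
        rw [← key a b]
        simp only [Finset.mul_sum]
        refine Finset.sum_congr rfl fun σ _ => Finset.sum_congr rfl fun τ _ => ?_
        simp only [RCLike.star_def]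
        ring
  rw [← hsum] at hN
  have h1 := (Complex.le_def.1 hN).1
  rw [← Complex.ofReal_natCast, Complex.re_ofReal_mul] at h1
  have h2 : (0 : ℝ) < n.factorial := by exact_mod_cast n.factorial_pos
  exact nonneg_of_mul_nonneg_right (by simpa using h1) h2

end Form

noncomputable section Fock

variable {H : Type*} [NormedAddCommGroup H] [InnerProductSpace ℂ H]

/-- Left tensoring `x ↦ v ⊗ x`. -/
def tensorLeft (n : ℕ) (v : H) : (⨂[ℂ] _ : Fin n, H) →ₗ[ℂ] (⨂[ℂ] _ : Fin (n + 1), H) :=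
  PiTensorProduct.lift ((PiTensorProduct.tprod ℂ (s := fun _ : Fin (n + 1) => H)).curryLeft v)

theorem tensorLeft_tprod (n : ℕ) (v : H) (w : Fin n → H) :
    tensorLeft n v (PiTensorProduct.tprod ℂ w) = PiTensorProduct.tprod ℂ (Fin.cons v w) := by
  simp [tensorLeft]

/-- The algebraic `q`-annihilation operator
`w₀ ⊗ ⋯ ⊗ wₙ ↦ ∑ k, q ^ k * ⟪v, wₖ⟫ • w₀ ⊗ ⋯ ⊗ (omit wₖ) ⊗ ⋯ ⊗ wₙ`. -/
def tensorContract (q : ℝ) (n : ℕ) (v : H) :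
    (⨂[ℂ] _ : Fin (n + 1), H) →ₗ[ℂ] (⨂[ℂ] _ : Fin n, H) :=
  ∑ k : Fin (n + 1), ((q : ℂ) ^ (k : ℕ)) • PiTensorProduct.lift
    (LinearMap.uncurryMid (M := fun _ : Fin (n + 1) => H) k
      ((innerₛₗ ℂ v).smulRight (PiTensorProduct.tprod ℂ (s := fun _ : Fin n => H))))

theorem tensorContract_tprod (q : ℝ) (n : ℕ) (v : H) (w : Fin (n + 1) → H) :
    tensorContract q n v (PiTensorProduct.tprod ℂ w) = ∑ k : Fin (n + 1),
      ((q : ℂ) ^ (k : ℕ) * ⟪v, w k⟫_ℂ) • PiTensorProduct.tprod ℂ (k.removeNth w) := by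
  simp [tensorContract, mul_smul]

theorem qForm_tensorLeft (q : ℝ) {n : ℕ} (v : H) (x : ⨂[ℂ] _ : Fin n, H)
    (y : ⨂[ℂ] _ : Fin (n + 1), H) :
    qForm q (n + 1) (tensorLeft n v x) y = qForm q n x (tensorContract q n v y) := by
  induction x using PiTensorProduct.induction_on with
  | add x x' hx hx' => rw [qForm_add_left, map_add, qForm_add_left, hx, hx']
  | smul_tprod c u =>
    induction y using PiTensorProduct.induction_on with
    | add y y' hy hy' => rw [qForm_add_right, map_add, qForm_add_right, hy, hy']
    | smul_tprod d w =>
      simp only [map_smul, qForm_smul_left, qForm_smul_right, tensorLeft_tprod,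
        tensorContract_tprod, qForm_sum_right, qForm_tprod]
      congr 1
      simp only [mul_left_comm _ (conj c), ← Finset.mul_sum]
      congr 1
      rw [← (consPerm_bijective (n := n)).sum_comp, Fintype.sum_prod_type]
      refine Finset.sum_congr rfl fun k _ => ?_
      rw [Finset.mul_sum]
      refine Finset.sum_congr rfl fun σ _ => ?_
      rw [inversions_consPerm, Fin.prod_univ_succ, consPerm_zero]
      have hp : ∏ i : Fin n, ⟪(Fin.cons v u : Fin (n + 1) → H) i.succ,
          w (consPerm (k, σ) i.succ)⟫_ℂ = ∏ i, ⟪u i, k.removeNth w (σ i)⟫_ℂ :=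
        Finset.prod_congr rfl fun i _ => by rw [consPerm_succ, Fin.cons_succ]; rfl
      rw [hp, pow_add, Fin.cons_zero]
      ring

theorem tensorContract_tensorLeft_zero (q : ℝ) (v w : H) (x : ⨂[ℂ] _ : Fin 0, H) :
    tensorContract q 0 v (tensorLeft 0 w x) = ⟪v, w⟫_ℂ • x := by
  induction x using PiTensorProduct.induction_on with
  | add x x' hx hx' => simp only [map_add, smul_add, hx, hx']
  | smul_tprod c u =>
    simp only [map_smul, tensorLeft_tprod, tensorContract_tprod]
    rw [smul_comm _ c, Fin.sum_univ_succ, Fin.sum_univ_zero, add_zero]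
    simp only [Fin.cons_zero, Fin.val_zero, pow_zero, one_mul]
    congr 3

/-- The `q`-commutation relation `a(v) a*(w) = ⟪v, w⟫ + q a*(w) a(v)`. -/
theorem tensorContract_tensorLeft_succ (q : ℝ) (n : ℕ) (v w : H) (x : ⨂[ℂ] _ : Fin (n + 1), H) :
    tensorContract q (n + 1) v (tensorLeft (n + 1) w x) =
      ⟪v, w⟫_ℂ • x + (q : ℂ) • tensorLeft n w (tensorContract q n v x) := by
  induction x using PiTensorProduct.induction_on with
  | add x x' hx hx' => simp only [map_add, smul_add, hx, hx']; abel
  | smul_tprod c u =>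
    simp only [map_smul, tensorLeft_tprod, tensorContract_tprod, map_sum]
    rw [Fin.sum_univ_succ, smul_comm _ c, smul_comm (q : ℂ) c, ← smul_add]
    simp only [Finset.smul_sum, Fin.cons_zero, Fin.cons_succ, Fin.val_zero, pow_zero, one_mul,
      Fin.val_succ]
    congr 2
    · refine Finset.sum_congr rfl fun k _ => ?_
      rw [smul_smul (q : ℂ), pow_succ', mul_assoc]
      have : (k.succ.removeNth (Fin.cons w u : Fin (n + 2) → H) : Fin (n + 1) → H) =
          Fin.cons w (k.removeNth u) := by
        ext i
        refine Fin.cases ?_ (fun j => ?_) i <;> simp [Fin.removeNth]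
      rw [this]

/-- The algebraic `n`-fold tensor power of `H`, to be equipped with the `q`-deformed
(semi-)inner product. -/
def AlgTensor (_q : Set.Ioo (-1 : ℝ) 1) (n : ℕ) (H : Type*) [NormedAddCommGroup H]
    [InnerProductSpace ℂ H] : Type _ :=
  ⨂[ℂ] _ : Fin n, H

instance instAddCommGroupAlgTensor (q : Set.Ioo (-1 : ℝ) 1) (n : ℕ) :
    AddCommGroup (AlgTensor q n H) :=
  inferInstanceAs (AddCommGroup (⨂[ℂ] _ : Fin n, H))

instance instModuleAlgTensor (q : Set.Ioo (-1 : ℝ) 1) (n : ℕ) :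
    Module ℂ (AlgTensor q n H) :=
  inferInstanceAs (Module ℂ (⨂[ℂ] _ : Fin n, H))

instance qCore (q : Set.Ioo (-1 : ℝ) 1) (n : ℕ) :
    PreInnerProductSpace.Core ℂ (AlgTensor q n H) where
  inner x y := qForm q n x y
  conj_inner_symm x y := qForm_conj_symm q x y
  re_inner_nonneg x := qForm_self_nonneg (abs_le.2 ⟨q.2.1.le, q.2.2.le⟩) x
  add_left x x' y := qForm_add_left q x x' y
  smul_left x y c := qForm_smul_left q c x y

instance instSeminormedAlgTensor (q : Set.Ioo (-1 : ℝ) 1) (n : ℕ) :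
    SeminormedAddCommGroup (AlgTensor q n H) :=
  InnerProductSpace.Core.toSeminormedAddCommGroup (𝕜 := ℂ)

instance instInnerAlgTensor (q : Set.Ioo (-1 : ℝ) 1) (n : ℕ) :
    InnerProductSpace ℂ (AlgTensor q n H) :=
  InnerProductSpace.ofCore (qCore q n)

theorem inner_algTensor (q : Set.Ioo (-1 : ℝ) 1) (n : ℕ) (x y : AlgTensor q n H) :
    ⟪x, y⟫_ℂ = qForm q n x y := rfl

/-- The Hilbert space `H_q^{⊗n}`: the completion of the algebraic tensor power with respect to
the `q`-deformed inner product. -/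
abbrev QTensor (q : Set.Ioo (-1 : ℝ) 1) (n : ℕ) (H : Type*) [NormedAddCommGroup H]
    [InnerProductSpace ℂ H] : Type _ :=
  UniformSpace.Completion (AlgTensor q n H)

/-- The `q`-Fock space `F_q(H)`, the Hilbert space direct sum of the `H_q^{⊗n}`, `n ≥ 0`. -/
abbrev FockSpace (q : Set.Ioo (-1 : ℝ) 1) (H : Type*) [NormedAddCommGroup H]
    [InnerProductSpace ℂ H] : Type _ :=
  lp (fun n => QTensor q n H) 2


end Fock

noncomputable section Operators

variable {H : Type*} [NormedAddCommGroup H] [InnerProductSpace ℂ H]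
variable {K : Type*} [NormedAddCommGroup K] [InnerProductSpace ℂ K]

/-- `x ↦ v ⊗ x` as a map between the algebraic tensor powers with their `q`-inner products. -/
def algCreation (q : Set.Ioo (-1 : ℝ) 1) (n : ℕ) (v : H) :
    AlgTensor q n H →ₗ[ℂ] AlgTensor q (n + 1) H :=
  tensorLeft n v

theorem norm_algCreation_sq_le (q : Set.Ioo (-1 : ℝ) 1) (n : ℕ) (v : H) (x : AlgTensor q n H) :
    ‖algCreation q n v x‖ ^ 2 ≤ ‖v‖ ^ 2 / (1 - |(q : ℝ)|) * ‖x‖ ^ 2 := by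
  have hq : 0 < 1 - |(q : ℝ)| := sub_pos.2 (abs_lt.2 q.2)
  have hadj : ∀ (m : ℕ) (y : AlgTensor q m H) (z : AlgTensor q (m + 1) H),
      ⟪algCreation q m v y, z⟫_ℂ = ⟪y, (tensorContract q m v z : AlgTensor q m H)⟫_ℂ :=
    fun m y z => qForm_tensorLeft q v y z
  have hsq : ∀ (m : ℕ) (y : AlgTensor q m H), ((‖y‖ ^ 2 : ℝ) : ℂ) = ⟪y, y⟫_ℂ := by
    intro m y
    rw [inner_self_eq_norm_sq_to_K]; simp
  induction n with
  | zero =>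
    have h : ‖algCreation q 0 v x‖ ^ 2 = ‖v‖ ^ 2 * ‖x‖ ^ 2 := by
      have : ((‖algCreation q 0 v x‖ ^ 2 : ℝ) : ℂ) = ((‖v‖ ^ 2 * ‖x‖ ^ 2 : ℝ) : ℂ) := by
        rw [hsq, hadj]
        have e : (tensorContract q 0 v (algCreation q 0 v x) : AlgTensor q 0 H) = ⟪v, v⟫_ℂ • x :=
          tensorContract_tensorLeft_zero q v v x
        rw [e, inner_smul_right, ← hsq, inner_self_eq_norm_sq_to_K]
        push_cast; simp
      exact_mod_cast this
    rw [h]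
    gcongr
    rw [le_div_iff₀ hq]
    nlinarith [abs_nonneg (q : ℝ), sq_nonneg ‖v‖, mul_nonneg (sq_nonneg ‖v‖) (abs_nonneg (q : ℝ))]
  | succ n ih =>
    set d : AlgTensor q n H := tensorContract q n v x with hd
    have h : ‖algCreation q (n + 1) v x‖ ^ 2 = ‖v‖ ^ 2 * ‖x‖ ^ 2 + q * ‖d‖ ^ 2 := by
      have : ((‖algCreation q (n + 1) v x‖ ^ 2 : ℝ) : ℂ) =
          ((‖v‖ ^ 2 * ‖x‖ ^ 2 + q * ‖d‖ ^ 2 : ℝ) : ℂ) := by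
        rw [hsq, hadj]
        have e : (tensorContract q (n + 1) v (algCreation q (n + 1) v x) : AlgTensor q (n + 1) H) =
            ⟪v, v⟫_ℂ • x + ((q : ℝ) : ℂ) • algCreation q n v d :=
          tensorContract_tensorLeft_succ q n v v x
        rw [e, inner_add_right, inner_smul_right, inner_smul_right, ← hsq,
          inner_self_eq_norm_sq_to_K, ← inner_conj_symm x, hadj, ← hd, ← hsq, Complex.conj_ofReal]
        push_cast; simp
      exact_mod_cast this
    have hdx : ‖d‖ ^ 2 ≤ ‖v‖ ^ 2 / (1 - |(q : ℝ)|) * ‖x‖ ^ 2 := by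
      have h1 : ‖d‖ ^ 2 ≤ ‖algCreation q n v d‖ * ‖x‖ := by
        have h2 : ((‖d‖ ^ 2 : ℝ) : ℂ) = ⟪algCreation q n v d, x⟫_ℂ := by rw [hsq, hadj]
        have h3 := norm_inner_le_norm (𝕜 := ℂ) (algCreation q n v d) x
        rwa [← h2, Complex.norm_real, Real.norm_of_nonneg (sq_nonneg _)] at h3
      have h4 := ih d
      rcases (norm_nonneg d).eq_or_lt with h0 | h0
      · rw [← h0, zero_pow two_ne_zero]; positivity
      · have h5 : (‖d‖ ^ 2) ^ 2 ≤ (‖v‖ ^ 2 / (1 - |(q : ℝ)|) * ‖x‖ ^ 2) * ‖d‖ ^ 2 := by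
          calc (‖d‖ ^ 2) ^ 2 ≤ (‖algCreation q n v d‖ * ‖x‖) ^ 2 := by gcongr
            _ = ‖algCreation q n v d‖ ^ 2 * ‖x‖ ^ 2 := by ring
            _ ≤ (‖v‖ ^ 2 / (1 - |(q : ℝ)|) * ‖d‖ ^ 2) * ‖x‖ ^ 2 := by gcongr
            _ = _ := by ring
        have h6 : 0 < ‖d‖ ^ 2 := by positivity
        exact le_of_mul_le_mul_right (by simpa [sq (‖d‖ ^ 2)] using h5) h6
    calc ‖algCreation q (n + 1) v x‖ ^ 2 = ‖v‖ ^ 2 * ‖x‖ ^ 2 + q * ‖d‖ ^ 2 := h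
      _ ≤ ‖v‖ ^ 2 * ‖x‖ ^ 2 + |(q : ℝ)| * (‖v‖ ^ 2 / (1 - |(q : ℝ)|) * ‖x‖ ^ 2) := by
        gcongr
        exact le_abs_self _
      _ = _ := by field_simp; ring

/-- A bound for the norm of the creation operator `a_q*(v)`. -/
def creationBound (q : Set.Ioo (-1 : ℝ) 1) (v : H) : ℝ :=
  √(‖v‖ ^ 2 / (1 - |(q : ℝ)|))

theorem norm_algCreation_le (q : Set.Ioo (-1 : ℝ) 1) (n : ℕ) (v : H) (x : AlgTensor q n H) :
    ‖algCreation q n v x‖ ≤ creationBound q v * ‖x‖ := by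
  have hq : 0 < 1 - |(q : ℝ)| := sub_pos.2 (abs_lt.2 q.2)
  refine le_of_sq_le_sq ?_ (by unfold creationBound; positivity)
  rw [mul_pow, creationBound, Real.sq_sqrt (by positivity)]
  exact norm_algCreation_sq_le q n v x

theorem norm_completion_le {E F : Type*} [SeminormedAddCommGroup E] [NormedSpace ℂ E]
    [SeminormedAddCommGroup F] [NormedSpace ℂ F] (f : E →L[ℂ] F) {C : ℝ}
    (hf : ∀ x, ‖f x‖ ≤ C * ‖x‖) (x : UniformSpace.Completion E) :
    ‖f.completion x‖ ≤ C * ‖x‖ := by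
  induction x using UniformSpace.Completion.induction_on with
  | hp =>
    exact isClosed_le (f.completion.continuous.norm) (continuous_const.mul continuous_norm)
  | ih x => simpa using hf x

/-- `x ↦ v ⊗ x` as a bounded operator `H_q^{⊗n} → H_q^{⊗(n+1)}`. -/
def levelCreation (q : Set.Ioo (-1 : ℝ) 1) (n : ℕ) (v : H) :
    QTensor q n H →L[ℂ] QTensor q (n + 1) H :=
  ((algCreation q n v).mkContinuous (creationBound q v) (norm_algCreation_le q n v)).completion

theorem norm_levelCreation_le (q : Set.Ioo (-1 : ℝ) 1) (n : ℕ) (v : H) (x : QTensor q n H) :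
    ‖levelCreation q n v x‖ ≤ creationBound q v * ‖x‖ :=
  norm_completion_le _ (norm_algCreation_le q n v) x

/-- The components of `a_q*(v) x`: zero in degree `0` and `v ⊗ xₙ` in degree `n + 1`. -/
def creationFun (q : Set.Ioo (-1 : ℝ) 1) (v : H) (x : ∀ n, QTensor q n H) : ∀ n, QTensor q n H
  | 0 => 0
  | n + 1 => levelCreation q n v (x n)

theorem summable_creationFun (q : Set.Ioo (-1 : ℝ) 1) (v : H) (x : FockSpace q H) :
    Summable (fun n => ‖levelCreation q n v (x n)‖ ^ 2) ∧
      ∑' n, ‖levelCreation q n v (x n)‖ ^ 2 ≤ (creationBound q v * ‖x‖) ^ 2 := by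
  have h := lp.hasSum_norm (p := 2) (by norm_num) x
  simp only [ENNReal.toReal_ofNat, Real.rpow_ofNat] at h
  have h' := h.mul_left (creationBound q v ^ 2)
  have hle : ∀ n, ‖levelCreation q n v (x n)‖ ^ 2 ≤ creationBound q v ^ 2 * ‖x n‖ ^ 2 := by
    intro n
    rw [← mul_pow]
    exact pow_le_pow_left₀ (norm_nonneg _) (norm_levelCreation_le q n v (x n)) 2
  have hs := Summable.of_nonneg_of_le (fun n => sq_nonneg _) hle h'.summable
  refine ⟨hs, ?_⟩
  rw [mul_pow, ← h'.tsum_eq]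
  exact hs.tsum_le_tsum hle h'.summable

theorem memℓp_creationFun (q : Set.Ioo (-1 : ℝ) 1) (v : H) (x : FockSpace q H) :
    Memℓp (creationFun q v x) 2 := by
  refine memℓp_gen ?_
  simp only [ENNReal.toReal_ofNat, Real.rpow_ofNat]
  rw [← summable_nat_add_iff 1]
  exact (summable_creationFun q v x).1

/-- The `q`-creation operator `a_q*(v)` on the `q`-Fock space, `x ↦ v ⊗ x`. -/
def creation (q : Set.Ioo (-1 : ℝ) 1) (v : H) : FockSpace q H →L[ℂ] FockSpace q H :=
  LinearMap.mkContinuous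
    { toFun := fun x => ⟨creationFun q v x, memℓp_creationFun q v x⟩
      map_add' := fun x y => by
        ext n
        cases n
        · exact (add_zero (0 : QTensor q 0 H)).symm
        · exact map_add (levelCreation q _ v) _ _
      map_smul' := fun c x => by
        ext n
        cases n <;> simp [creationFun] }
    (creationBound q v) (fun x => by
      refine le_of_sq_le_sq ?_ (mul_nonneg (Real.sqrt_nonneg _) (norm_nonneg _))
      have h := lp.norm_rpow_eq_tsum (p := 2) (by norm_num)
        (⟨creationFun q v x, memℓp_creationFun q v x⟩ : FockSpace q H)
      simp only [ENNReal.toReal_ofNat, Real.rpow_ofNat] at h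
      have hs := (summable_creationFun q v x)
      have hs' : Summable fun n => ‖creationFun q v x n‖ ^ 2 :=
        (summable_nat_add_iff 1).1 hs.1
      refine h.trans_le ?_
      rw [hs'.tsum_eq_zero_add]
      simpa [creationFun] using hs.2)

@[simp] theorem creation_apply_zero (q : Set.Ioo (-1 : ℝ) 1) (v : H) (x : FockSpace q H) :
    creation q v x 0 = 0 := rfl

@[simp] theorem creation_apply_succ (q : Set.Ioo (-1 : ℝ) 1) (v : H) (x : FockSpace q H) (n : ℕ) :
    creation q v x (n + 1) = levelCreation q n v (x n) := rfl

/-- `T^{⊗n}` on algebraic tensor powers. -/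
def algMap (q : Set.Ioo (-1 : ℝ) 1) (n : ℕ) (T : K →ₗ[ℂ] H) :
    AlgTensor q n K →ₗ[ℂ] AlgTensor q n H :=
  PiTensorProduct.map fun _ => T

theorem qForm_map (q : ℝ) {n : ℕ} (ι : K →ₗᵢ[ℂ] H) (x y : ⨂[ℂ] _ : Fin n, K) :
    qForm q n (PiTensorProduct.map (fun _ => ι.toLinearMap) x)
      (PiTensorProduct.map (fun _ => ι.toLinearMap) y) = qForm q n x y := by
  induction x using PiTensorProduct.induction_on with
  | add x x' hx hx' => rw [map_add, qForm_add_left, qForm_add_left, hx, hx']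
  | smul_tprod c u =>
    induction y using PiTensorProduct.induction_on with
    | add y y' hy hy' => rw [map_add, qForm_add_right, qForm_add_right, hy, hy']
    | smul_tprod d w =>
      simp [qForm_smul_left, qForm_smul_right, qForm_tprod]

theorem inner_algMap (q : Set.Ioo (-1 : ℝ) 1) (n : ℕ) (ι : K →ₗᵢ[ℂ] H) (x y : AlgTensor q n K) :
    ⟪algMap q n ι.toLinearMap x, algMap q n ι.toLinearMap y⟫_ℂ = ⟪x, y⟫_ℂ :=
  qForm_map q ι x y

theorem norm_algMap (q : Set.Ioo (-1 : ℝ) 1) (n : ℕ) (ι : K →ₗᵢ[ℂ] H) (x : AlgTensor q n K) :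
    ‖algMap q n ι.toLinearMap x‖ = ‖x‖ := by
  rw [norm_eq_sqrt_re_inner (𝕜 := ℂ), inner_algMap, ← norm_eq_sqrt_re_inner]

/-- `ι^{⊗n}` as a bounded operator `K_q^{⊗n} → H_q^{⊗n}`, for an isometry `ι`. -/
def levelMap (q : Set.Ioo (-1 : ℝ) 1) (n : ℕ) (ι : K →ₗᵢ[ℂ] H) :
    QTensor q n K →L[ℂ] QTensor q n H :=
  ((algMap q n ι.toLinearMap).mkContinuous 1
    (fun x => by rw [norm_algMap, one_mul])).completion

/-- The first quantisation `F_q(ι) : F_q(K) → F_q(H)` of a (linear) isometry `ι : K → H`, acting by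
`v₁ ⊗ ⋯ ⊗ vₙ ↦ ι v₁ ⊗ ⋯ ⊗ ι vₙ`. It identifies `F_q(K)` with a closed subspace of `F_q(H)`. -/
def firstQuantisation (q : Set.Ioo (-1 : ℝ) 1) (ι : K →ₗᵢ[ℂ] H) :
    FockSpace q K →L[ℂ] FockSpace q H :=
  lp.mapCLM 2 (fun n => levelMap q n ι) zero_le_one (fun n =>
    ContinuousLinearMap.opNorm_le_bound _ zero_le_one
      (norm_completion_le _ (fun x => by simp [norm_algMap])))

/-- The relative `q`-Toeplitz algebra `T_q(S, H)`: the (unital) C*-subalgebra of `B(F_q(H))`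
generated by the creation operators `a_q*(v)`, `v ∈ S`. -/
def relToeplitz (q : Set.Ioo (-1 : ℝ) 1) (S : Submodule ℂ H) :
    StarSubalgebra ℂ (FockSpace q H →L[ℂ] FockSpace q H) :=
  (StarAlgebra.adjoin ℂ (creation q '' (S : Set H))).topologicalClosure

/-- The `q`-Toeplitz algebra `T_q(H)`. -/
def toeplitz (q : Set.Ioo (-1 : ℝ) 1) (H : Type*) [NormedAddCommGroup H] [InnerProductSpace ℂ H] :
    StarSubalgebra ℂ (FockSpace q H →L[ℂ] FockSpace q H) :=
  relToeplitz q (⊤ : Submodule ℂ H)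

end Operators

end QFock

namespace QFock
open scoped InnerProductSpace

/-! ### The q-commutation relation and the intertwining by `F_q(ι)` -/

section Commutation

open ContinuousLinearMap

variable {H : Type*} [NormedAddCommGroup H] [InnerProductSpace ℂ H]
variable {K : Type*} [NormedAddCommGroup K] [InnerProductSpace ℂ K]

/-! Write `V = F_q(ι)`, `a*(v)` for creation and `a(v)` for its adjoint. Both `a*(ιv)` and `a(ιv)`
carry the range of `V` into itself, acting there as `a*(v)` and `a(v)` on `F_q(K)`. Hence `x V = V
(V* x V)` for every `x` in the C*-algebra generated by the `a*(ιv)`, by passing to products, sums,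
adjoints and limits; multiplicativity of the compression follows (`compression_mem_and_comp_eq`,
`relToeplitz_compression`).

Injectivity rests on the universality of the vacuum state. Let `S` be the range of `ι`, and call `ξ`
a vacuum vector if `a(v) ξ = 0` for all `v` in `S`. By the relation `a(v) a*(w) = ⟪v, w⟫ + q a*(w)
a(v)`, the `*`-algebra of the `a*(v)`, `v` in `S`, is spanned by products `P R*` of words `P`, `R`
in creation operators (`adjoin_le_wickSpan`). Since `⟪ξ, P R* ξ⟫ = ⟪P* ξ, R* ξ⟫` vanishes unless
both words are trivial, all vacuum vectors give the same state up to normalisation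
(`IsVacuum.inner_apply_mul`). Vectors `P ξ`, with `ξ` an arbitrary vacuum vector, are total in
`F_q(H)` by induction on the degree (`eq_zero_of_inner_word_vacuum`).

If the compression of `x` is zero, then `x V = 0`, so `x` kills every `P Ω`, where `Ω` is the Fock
vacuum. Comparing the states of `Ω` and `ξ` on `(xP)*(xP)` gives `x P ξ = 0` for every vacuum vector
`ξ`, and totality gives `x = 0`. -/

theorem levelCreation_coe (q : Set.Ioo (-1 : ℝ) 1) (n : ℕ) (v : H) (x : AlgTensor q n H) :
    levelCreation q n v (x : QTensor q n H) = (algCreation q n v x : QTensor q (n + 1) H) :=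
  completion_apply_coe _ x

theorem levelMap_coe (q : Set.Ioo (-1 : ℝ) 1) (n : ℕ) (ι : K →ₗᵢ[ℂ] H) (x : AlgTensor q n K) :
    levelMap q n ι (x : QTensor q n K) = (algMap q n ι.toLinearMap x : QTensor q n H) :=
  completion_apply_coe _ x

/-- The algebraic `q`-annihilation operator between the algebraic tensor powers with their
`q`-inner products. -/
noncomputable def algAnnihilation (q : Set.Ioo (-1 : ℝ) 1) (n : ℕ) (v : H) :
    AlgTensor q (n + 1) H →ₗ[ℂ] AlgTensor q n H :=
  tensorContract q n v

theorem completion_hom_ext {E F : Type*} [SeminormedAddCommGroup E] [NormedSpace ℂ E]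
    [NormedAddCommGroup F] [NormedSpace ℂ F] {f g : UniformSpace.Completion E →L[ℂ] F}
    (h : ∀ x : E, f x = g x) : f = g := by
  ext x
  induction x using UniformSpace.Completion.induction_on with
  | hp => exact isClosed_eq f.continuous g.continuous
  | ih x => exact h x

theorem adjoint_levelCreation_coe (q : Set.Ioo (-1 : ℝ) 1) (n : ℕ) (v : H)
    (y : AlgTensor q (n + 1) H) :
    adjoint (levelCreation q n v) (y : QTensor q (n + 1) H) =
      (algAnnihilation q n v y : QTensor q n H) := by
  refine ext_inner_left ℂ fun z => ?_
  induction z using UniformSpace.Completion.induction_on with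
  | hp =>
    exact isClosed_eq (continuous_id.inner continuous_const) (continuous_id.inner continuous_const)
  | ih z =>
    rw [adjoint_inner_right, levelCreation_coe, UniformSpace.Completion.inner_coe,
      UniformSpace.Completion.inner_coe]
    exact qForm_tensorLeft q v z y

/-- Degree zero is separate: there is nothing to annihilate, so the term with the factor `q` is
absent. -/
theorem adjoint_levelCreation_comp_levelCreation_zero (q : Set.Ioo (-1 : ℝ) 1) (v w : H) :
    adjoint (levelCreation q 0 v) ∘L levelCreation q 0 w =
      ⟪v, w⟫_ℂ • ContinuousLinearMap.id ℂ (QTensor q 0 H) := by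
  refine completion_hom_ext fun x => ?_
  rw [comp_apply, levelCreation_coe, adjoint_levelCreation_coe, smul_apply, id_apply,
    ← UniformSpace.Completion.coe_smul]
  exact congrArg _ (tensorContract_tensorLeft_zero q v w x)

theorem adjoint_levelCreation_comp_levelCreation_succ (q : Set.Ioo (-1 : ℝ) 1) (n : ℕ) (v w : H) :
    adjoint (levelCreation q (n + 1) v) ∘L levelCreation q (n + 1) w =
      ⟪v, w⟫_ℂ • ContinuousLinearMap.id ℂ (QTensor q (n + 1) H) +
        ((q : ℝ) : ℂ) • (levelCreation q n w ∘L adjoint (levelCreation q n v)) := by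
  refine completion_hom_ext fun x => ?_
  rw [comp_apply, levelCreation_coe, adjoint_levelCreation_coe, add_apply, smul_apply, smul_apply,
    id_apply, comp_apply, adjoint_levelCreation_coe, levelCreation_coe,
    ← UniformSpace.Completion.coe_smul, ← UniformSpace.Completion.coe_smul,
    ← UniformSpace.Completion.coe_add]
  exact congrArg _ (tensorContract_tensorLeft_succ q n v w x)

theorem inner_single_left (q : Set.Ioo (-1 : ℝ) 1) (n : ℕ) (z : QTensor q n H)
    (x : FockSpace q H) : ⟪(lp.single 2 n z : FockSpace q H), x⟫_ℂ = ⟪z, x n⟫_ℂ :=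
  lp.inner_single_left (𝕜 := ℂ) (G := fun n => QTensor q n H) n z x

theorem creation_single (q : Set.Ioo (-1 : ℝ) 1) (v : H) (n : ℕ) (z : QTensor q n H) :
    creation q v (lp.single 2 n z) = lp.single 2 (n + 1) (levelCreation q n v z) := by
  ext m
  cases m with
  | zero => simp
  | succ m =>
    rw [creation_apply_succ]
    by_cases h : m = n
    · subst h; simp
    · simp [Pi.single_eq_of_ne, h]

theorem adjoint_creation_apply (q : Set.Ioo (-1 : ℝ) 1) (v : H) (x : FockSpace q H) (n : ℕ) :
    adjoint (creation q v) x n = adjoint (levelCreation q n v) (x (n + 1)) := by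
  -- Pairing with vectors concentrated in degree `n` reads off the component, and creation shifts
  -- such a vector to degree `n + 1`.
  refine ext_inner_left ℂ fun (z : QTensor q n H) => ?_
  refine (inner_single_left q n z _).symm.trans ?_
  rw [adjoint_inner_right, adjoint_inner_right, creation_single, inner_single_left]

/-- The `q`-commutation relation on the `q`-Fock space. -/
theorem star_creation_mul_creation (q : Set.Ioo (-1 : ℝ) 1) (v w : H) :
    star (creation q v) * creation q w =
      ⟪v, w⟫_ℂ • (1 : FockSpace q H →L[ℂ] FockSpace q H) +
        ((q : ℝ) : ℂ) • (creation q w * star (creation q v)) := by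
  ext x n
  change adjoint (creation q v) (creation q w x) n =
    ⟪v, w⟫_ℂ • x n + ((q : ℝ) : ℂ) • creation q w (adjoint (creation q v) x) n
  rw [adjoint_creation_apply, creation_apply_succ]
  cases n with
  | zero =>
    rw [creation_apply_zero, smul_zero, add_zero]
    exact DFunLike.congr_fun (adjoint_levelCreation_comp_levelCreation_zero q v w) (x 0)
  | succ n =>
    rw [creation_apply_succ, adjoint_creation_apply]
    exact DFunLike.congr_fun (adjoint_levelCreation_comp_levelCreation_succ q n v w) (x (n + 1))

theorem levelCreation_comp_levelMap (q : Set.Ioo (-1 : ℝ) 1) (n : ℕ) (ι : K →ₗᵢ[ℂ] H) (v : K) :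
    levelCreation q n (ι v) ∘L levelMap q n ι = levelMap q (n + 1) ι ∘L levelCreation q n v := by
  refine completion_hom_ext fun x => ?_
  rw [comp_apply, comp_apply, levelMap_coe, levelCreation_coe, levelCreation_coe, levelMap_coe]
  congr 1
  change tensorLeft n (ι v) (PiTensorProduct.map (fun _ => ι.toLinearMap) x) =
    PiTensorProduct.map (fun _ => ι.toLinearMap) (tensorLeft n v x)
  induction x using PiTensorProduct.induction_on with
  | add x y hx hy => simp only [map_add, hx, hy]
  | smul_tprod c w =>
    simp only [map_smul, PiTensorProduct.map_tprod, tensorLeft_tprod]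
    congr 2
    ext i
    refine Fin.cases ?_ (fun j => ?_) i <;> simp

/-- Here it matters that `ι` is isometric and not only linear: the coefficients `⟪ι v, ι wₖ⟫` of the
annihilation operator must equal `⟪v, wₖ⟫`. Together with the relation for creation operators this
makes the range of `F_q(ι)` reducing. -/
theorem adjoint_levelCreation_comp_levelMap (q : Set.Ioo (-1 : ℝ) 1) (n : ℕ) (ι : K →ₗᵢ[ℂ] H)
    (v : K) :
    adjoint (levelCreation q n (ι v)) ∘L levelMap q (n + 1) ι =
      levelMap q n ι ∘L adjoint (levelCreation q n v) := by
  refine completion_hom_ext fun x => ?_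
  rw [comp_apply, comp_apply, levelMap_coe, adjoint_levelCreation_coe, adjoint_levelCreation_coe,
    levelMap_coe]
  congr 1
  change tensorContract q n (ι v) (PiTensorProduct.map (fun _ => ι.toLinearMap) x) =
    PiTensorProduct.map (fun _ => ι.toLinearMap) (tensorContract q n v x)
  induction x using PiTensorProduct.induction_on with
  | add x y hx hy => simp only [map_add, hx, hy]
  | smul_tprod c w =>
    simp only [map_smul, PiTensorProduct.map_tprod, tensorContract_tprod, map_sum]
    congr 1
    refine Finset.sum_congr rfl fun k _ => ?_
    congr 1
    simp

theorem firstQuantisation_apply (q : Set.Ioo (-1 : ℝ) 1) (ι : K →ₗᵢ[ℂ] H) (x : FockSpace q K)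
    (n : ℕ) : firstQuantisation q ι x n = levelMap q n ι (x n) := rfl

theorem creation_comp_firstQuantisation (q : Set.Ioo (-1 : ℝ) 1) (ι : K →ₗᵢ[ℂ] H) (v : K) :
    creation q (ι v) ∘L firstQuantisation q ι = firstQuantisation q ι ∘L creation q v := by
  ext x n
  change creation q (ι v) (firstQuantisation q ι x) n = firstQuantisation q ι (creation q v x) n
  rw [firstQuantisation_apply]
  cases n with
  | zero => rw [creation_apply_zero, creation_apply_zero, map_zero]
  | succ n =>
    rw [creation_apply_succ, creation_apply_succ, firstQuantisation_apply]
    exact DFunLike.congr_fun (levelCreation_comp_levelMap q n ι v) (x n)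

theorem star_creation_comp_firstQuantisation (q : Set.Ioo (-1 : ℝ) 1) (ι : K →ₗᵢ[ℂ] H) (v : K) :
    star (creation q (ι v)) ∘L firstQuantisation q ι =
      firstQuantisation q ι ∘L star (creation q v) := by
  ext x n
  change adjoint (creation q (ι v)) (firstQuantisation q ι x) n =
    firstQuantisation q ι (adjoint (creation q v) x) n
  rw [firstQuantisation_apply, adjoint_creation_apply, adjoint_creation_apply,
    firstQuantisation_apply]
  exact DFunLike.congr_fun (adjoint_levelCreation_comp_levelMap q n ι v) (x (n + 1))

theorem adjoint_firstQuantisation_comp_self (q : Set.Ioo (-1 : ℝ) 1) (ι : K →ₗᵢ[ℂ] H) :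
    adjoint (firstQuantisation q ι) ∘L firstQuantisation q ι =
      (1 : FockSpace q K →L[ℂ] FockSpace q K) := by
  have hl : ∀ (n : ℕ) (x y : QTensor q n K), ⟪levelMap q n ι x, levelMap q n ι y⟫_ℂ = ⟪x, y⟫_ℂ := by
    intro n x y
    induction x, y using UniformSpace.Completion.induction_on₂ with
    | hp =>
      exact isClosed_eq (((levelMap q n ι).continuous.comp continuous_fst).inner
        ((levelMap q n ι).continuous.comp continuous_snd)) (continuous_fst.inner continuous_snd)
    | ih x y =>
      rw [levelMap_coe, levelMap_coe, UniformSpace.Completion.inner_coe,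
        UniformSpace.Completion.inner_coe, inner_algMap]
  refine ContinuousLinearMap.ext fun y => ext_inner_left ℂ fun x => ?_
  change ⟪x, adjoint (firstQuantisation q ι) (firstQuantisation q ι y)⟫_ℂ = ⟪x, y⟫_ℂ
  rw [adjoint_inner_right, lp.inner_eq_tsum, lp.inner_eq_tsum]
  simp only [firstQuantisation_apply, hl]

end Commutation

/-! ### Compression of operators to a reducing subspace -/

section Compression

open ContinuousLinearMap

variable {E : Type*} [NormedAddCommGroup E] [InnerProductSpace ℂ E] [CompleteSpace E]
variable {F : Type*} [NormedAddCommGroup F] [InnerProductSpace ℂ F] [CompleteSpace F]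

/-- The compression `x ↦ V* x V` of operators along `V`. -/
noncomputable def compression (V : E →L[ℂ] F) (x : F →L[ℂ] F) : E →L[ℂ] E :=
  adjoint V ∘L (x ∘L V)

theorem continuous_compression (V : E →L[ℂ] F) : Continuous (compression V) := by
  unfold compression
  fun_prop

theorem star_compression (V : E →L[ℂ] F) (x : F →L[ℂ] F) :
    star (compression V x) = compression V (star x) := by
  simp only [compression, star_eq_adjoint, adjoint_comp, adjoint_adjoint]
  rfl

/-- Since `V* V = 1`, the factor `V` cancels on the left. An operator `y` intertwined with `x` is
therefore unique, and computing a compression reduces to checking an intertwining relation. -/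
theorem compression_eq_of_comp_eq {V : E →L[ℂ] F} (hV : adjoint V ∘L V = 1) {x : F →L[ℂ] F}
    {y : E →L[ℂ] E} (h : x ∘L V = V ∘L y) : compression V x = y := by
  rw [compression, h, ← comp_assoc, hV]
  rfl

/-- The relation is carried for `x` and `star x` together: invariance of the range of `V` under `x`
alone does not survive taking adjoints. -/
theorem exists_comp_eq_of_mem_adjoin {V : E →L[ℂ] F} {s : Set (F →L[ℂ] F)}
    {T : StarSubalgebra ℂ (E →L[ℂ] E)}
    (hs : ∀ x ∈ s, ∃ y ∈ T, x ∘L V = V ∘L y ∧ star x ∘L V = V ∘L star y)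
    {x : F →L[ℂ] F} (hx : x ∈ StarAlgebra.adjoin ℂ s) :
    ∃ y ∈ T, x ∘L V = V ∘L y ∧ star x ∘L V = V ∘L star y := by
  induction hx using StarAlgebra.adjoin_induction with
  | mem x hx => exact hs x hx
  | algebraMap r =>
    have h : ∀ c : ℂ, algebraMap ℂ (F →L[ℂ] F) c ∘L V = V ∘L algebraMap ℂ (E →L[ℂ] E) c := by
      intro c
      ext x
      simp [Algebra.algebraMap_eq_smul_one]
    refine ⟨algebraMap ℂ _ r, algebraMap_mem _ r, h r, ?_⟩
    rw [← algebraMap_star_comm, ← algebraMap_star_comm]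
    exact h _
  | add x x' _ _ h h' =>
    obtain ⟨y, hy, h1, h2⟩ := h
    obtain ⟨y', hy', h1', h2'⟩ := h'
    refine ⟨y + y', add_mem hy hy', ?_, ?_⟩
    · rw [add_comp, comp_add, h1, h1']
    · rw [star_add, star_add, add_comp, comp_add, h2, h2']
  | mul x x' _ _ h h' =>
    obtain ⟨y, hy, h1, h2⟩ := h
    obtain ⟨y', hy', h1', h2'⟩ := h'
    refine ⟨y * y', mul_mem hy hy', ?_, ?_⟩
    · rw [mul_def, comp_assoc, h1', ← comp_assoc, h1]; rfl
    · rw [star_mul, star_mul, mul_def, comp_assoc, h2, ← comp_assoc, h2']; rfl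
  | star x _ h =>
    obtain ⟨y, hy, h1, h2⟩ := h
    exact ⟨star y, star_mem hy, h2, by rwa [star_star, star_star]⟩

/-- If the generators of a C*-algebra of operators, and their adjoints, are intertwined by an
isometry `V` with elements of a C*-algebra `T`, then every element is intertwined with its
compression, which lies in `T`. -/
theorem compression_mem_and_comp_eq {V : E →L[ℂ] F} (hV : adjoint V ∘L V = 1)
    {s : Set (F →L[ℂ] F)} {T : StarSubalgebra ℂ (E →L[ℂ] E)}
    (hT : IsClosed (T : Set (E →L[ℂ] E)))
    (hs : ∀ x ∈ s, ∃ y ∈ T, x ∘L V = V ∘L y ∧ star x ∘L V = V ∘L star y)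
    {x : F →L[ℂ] F} (hx : x ∈ (StarAlgebra.adjoin ℂ s).topologicalClosure) :
    compression V x ∈ T ∧ x ∘L V = V ∘L compression V x := by
  -- Naming the partner of `x` as its compression, a continuous function of `x`, turns the
  -- existential statement into a closed condition.
  refine closure_minimal (s := (StarAlgebra.adjoin ℂ s : Set (F →L[ℂ] F)))
    (t := {x | compression V x ∈ T ∧ x ∘L V = V ∘L compression V x}) ?_ ?_ hx
  · intro x hx
    obtain ⟨y, hy, hxy, -⟩ := exists_comp_eq_of_mem_adjoin hs hx
    have e := compression_eq_of_comp_eq hV hxy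
    exact ⟨e ▸ hy, e ▸ hxy⟩
  · have hc := continuous_compression V
    exact IsClosed.inter (IsClosed.preimage hc hT) (isClosed_eq (by fun_prop) (by fun_prop))

/-- The compression along an isometry `V`, as a `*`-homomorphism on a `*`-algebra of operators that
`V` intertwines with their compressions. -/
noncomputable def compressionHom {V : E →L[ℂ] F} (hV : adjoint V ∘L V = 1)
    {A : StarSubalgebra ℂ (F →L[ℂ] F)} {T : StarSubalgebra ℂ (E →L[ℂ] E)}
    (h : ∀ x ∈ A, compression V x ∈ T ∧ x ∘L V = V ∘L compression V x) : A →⋆ₐ[ℂ] T where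
  toFun x := ⟨compression V x, (h x x.2).1⟩
  map_one' := Subtype.ext (compression_eq_of_comp_eq hV rfl)
  -- Intertwining moves `V` leftwards past `y` and then past `x`, which is what makes the
  -- compression multiplicative.
  map_mul' x y := Subtype.ext <| compression_eq_of_comp_eq hV <| by
    change (x.1 ∘L y.1) ∘L V = V ∘L (compression V x ∘L compression V y)
    rw [comp_assoc, (h y y.2).2, ← comp_assoc, (h x x.2).2, comp_assoc]
  map_zero' := Subtype.ext (by
    change compression V 0 = 0
    simp [compression])
  map_add' x y := Subtype.ext (by
    change compression V (x.1 + y.1) = compression V x + compression V y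
    simp [compression])
  commutes' r := Subtype.ext <| compression_eq_of_comp_eq hV <| by
    ext x
    simp [Algebra.algebraMap_eq_smul_one]
  map_star' x := Subtype.ext (star_compression V x).symm

end Compression

/-! ### The compression homomorphism on the relative Toeplitz algebra -/

section Toeplitz

open ContinuousLinearMap

variable {H : Type*} [NormedAddCommGroup H] [InnerProductSpace ℂ H]
variable {K : Type*} [NormedAddCommGroup K] [InnerProductSpace ℂ K]

theorem creation_mem_toeplitz (q : Set.Ioo (-1 : ℝ) 1) (v : K) : creation q v ∈ toeplitz q K :=
  StarSubalgebra.le_topologicalClosure _ (StarAlgebra.subset_adjoin ℂ _ ⟨v, trivial, rfl⟩)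

/-- Elements of the relative `q`-Toeplitz algebra intertwine with their compressions, which
lie in the `q`-Toeplitz algebra. -/
theorem relToeplitz_compression (q : Set.Ioo (-1 : ℝ) 1) (ι : K →ₗᵢ[ℂ] H) :
    ∀ x ∈ relToeplitz q (LinearMap.range ι.toLinearMap),
      compression (firstQuantisation q ι) x ∈ toeplitz q K ∧
      x ∘L firstQuantisation q ι =
        firstQuantisation q ι ∘L compression (firstQuantisation q ι) x := by
  intro x hx
  refine compression_mem_and_comp_eq (adjoint_firstQuantisation_comp_self q ι)
    (StarSubalgebra.isClosed_topologicalClosure _) ?_ hx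
  rintro _ ⟨_, ⟨v, rfl⟩, rfl⟩
  exact ⟨creation q v, creation_mem_toeplitz q v, creation_comp_firstQuantisation q ι v,
    star_creation_comp_firstQuantisation q ι v⟩

/-- The compression as a `*`-homomorphism `T_q(ι K, H) → T_q(K)`. -/
noncomputable def toeplitzCompression (q : Set.Ioo (-1 : ℝ) 1) (ι : K →ₗᵢ[ℂ] H) :
    relToeplitz q (LinearMap.range ι.toLinearMap) →⋆ₐ[ℂ] toeplitz q K :=
  compressionHom (adjoint_firstQuantisation_comp_self q ι) (relToeplitz_compression q ι)

end Toeplitz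

/-! ### Wick ordering, vacuum vectors and their state -/

section Wick

open ContinuousLinearMap

variable {H : Type*} [NormedAddCommGroup H] [InnerProductSpace ℂ H]

/-- The monoid of words in the creation operators `a_q*(v)`, `v ∈ S`. -/
noncomputable def creationWords (q : Set.Ioo (-1 : ℝ) 1) (S : Submodule ℂ H) :
    Submonoid (FockSpace q H →L[ℂ] FockSpace q H) :=
  Submonoid.closure (creation q '' (S : Set H))

/-- Vectors annihilated by all annihilation operators of vectors in `S`. -/
def IsVacuum (q : Set.Ioo (-1 : ℝ) 1) (S : Submodule ℂ H) (ξ : FockSpace q H) : Prop :=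
  ∀ v ∈ S, star (creation q v) ξ = 0

/-- The span of the Wick ordered products `P * star R`, with `P`, `R` words in creation
operators. -/
noncomputable def wickSpan (q : Set.Ioo (-1 : ℝ) 1) (S : Submodule ℂ H) :
    Submodule ℂ (FockSpace q H →L[ℂ] FockSpace q H) :=
  Submodule.span ℂ {x | ∃ P ∈ creationWords q S, ∃ R ∈ creationWords q S, x = P * star R}

theorem creation_mem_creationWords (q : Set.Ioo (-1 : ℝ) 1) {S : Submodule ℂ H} {v : H}
    (hv : v ∈ S) : creation q v ∈ creationWords q S :=
  Submonoid.subset_closure ⟨v, hv, rfl⟩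

theorem mul_star_mem_wickSpan (q : Set.Ioo (-1 : ℝ) 1) {S : Submodule ℂ H}
    {P R : FockSpace q H →L[ℂ] FockSpace q H}
    (hP : P ∈ creationWords q S) (hR : R ∈ creationWords q S) : P * star R ∈ wickSpan q S :=
  Submodule.subset_span ⟨P, hP, R, hR, rfl⟩

theorem creation_mul_mem_wickSpan (q : Set.Ioo (-1 : ℝ) 1) {S : Submodule ℂ H} {v : H}
    (hv : v ∈ S) {x : FockSpace q H →L[ℂ] FockSpace q H} (hx : x ∈ wickSpan q S) :
    creation q v * x ∈ wickSpan q S := by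
  suffices h : wickSpan q S ≤ (wickSpan q S).comap (LinearMap.mulLeft ℂ (creation q v)) from h hx
  refine Submodule.span_le.2 ?_
  rintro _ ⟨P, hP, R, hR, rfl⟩
  change creation q v * (P * star R) ∈ wickSpan q S
  rw [← mul_assoc]
  exact mul_star_mem_wickSpan q (mul_mem (creation_mem_creationWords q hv) hP) hR

/-- The commutation relation pushes an annihilation operator to the right through the word `P`, one
letter at a time, each exchange leaving a scalar term with a shorter word. -/
theorem star_creation_mul_mem_wickSpan (q : Set.Ioo (-1 : ℝ) 1) {S : Submodule ℂ H} {v : H}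
    (hv : v ∈ S) {x : FockSpace q H →L[ℂ] FockSpace q H} (hx : x ∈ wickSpan q S) :
    star (creation q v) * x ∈ wickSpan q S := by
  suffices h : wickSpan q S ≤
    (wickSpan q S).comap (LinearMap.mulLeft ℂ (star (creation q v))) from h hx
  refine Submodule.span_le.2 ?_
  rintro _ ⟨P, hP, R, hR, rfl⟩
  change star (creation q v) * (P * star R) ∈ wickSpan q S
  induction hP using Submonoid.closure_induction_left with
  | one =>
    -- Once `P` is used up, the annihilation operator is absorbed into the right factor: `a(v) R* =
    -- (R a*(v))*`.
    rw [one_mul, ← star_mul, ← one_mul (star _)]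
    exact mul_star_mem_wickSpan q (one_mem _) (mul_mem hR (creation_mem_creationWords q hv))
  | mul_left y hy P hP ih =>
    obtain ⟨w, hw, rfl⟩ := hy
    rw [mul_assoc, ← mul_assoc, star_creation_mul_creation, add_mul, smul_mul_assoc,
      smul_mul_assoc, one_mul, mul_assoc]
    exact add_mem (Submodule.smul_mem _ _ (mul_star_mem_wickSpan q hP hR))
      (Submodule.smul_mem _ _ (creation_mul_mem_wickSpan q hw ih))

/-- The `*`-algebra is spanned by mixed words in the generators and their adjoints; such a word is
built by left multiplications, and both kinds of letter preserve `wickSpan`. -/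
theorem adjoin_le_wickSpan (q : Set.Ioo (-1 : ℝ) 1) (S : Submodule ℂ H)
    {x : FockSpace q H →L[ℂ] FockSpace q H}
    (hx : x ∈ StarAlgebra.adjoin ℂ (creation q '' (S : Set H))) : x ∈ wickSpan q S := by
  have hx' : x ∈ Subalgebra.toSubmodule
      (Algebra.adjoin ℂ (creation q '' (S : Set H) ∪ star (creation q '' (S : Set H)))) := hx
  rw [Algebra.adjoin_eq_span] at hx'
  refine Submodule.span_le.2 (fun y hy => ?_) hx'
  induction hy using Submonoid.closure_induction_left with
  | one => simpa using mul_star_mem_wickSpan q (one_mem (creationWords q S)) (one_mem _)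
  | mul_left a ha y _ ih =>
    rcases ha with ⟨v, hv, rfl⟩ | ⟨v, hv, e⟩
    · exact creation_mul_mem_wickSpan q hv ih
    · rw [← star_star a, ← e]
      exact star_creation_mul_mem_wickSpan q hv ih

/-- In the adjoint of a nonempty word, the first letter of the word acts first, as an annihilation
operator. -/
theorem IsVacuum.star_word_apply {q : Set.Ioo (-1 : ℝ) 1} {S : Submodule ℂ H}
    {P : FockSpace q H →L[ℂ] FockSpace q H} (hP : P ∈ creationWords q S) :
    P = 1 ∨ ∀ ξ, IsVacuum q S ξ → star P ξ = 0 := by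
  induction hP using Submonoid.closure_induction_left with
  | one => exact Or.inl rfl
  | mul_left y hy P hP ih =>
    obtain ⟨w, hw, rfl⟩ := hy
    refine Or.inr fun ξ hξ => ?_
    rw [star_mul]
    change star P (star (creation q w) ξ) = 0
    rw [hξ w hw, map_zero]

/-- All vacuum vectors induce the same state on the relative `q`-Toeplitz algebra. -/
theorem IsVacuum.inner_apply_mul {q : Set.Ioo (-1 : ℝ) 1} {S : Submodule ℂ H}
    {ξ η : FockSpace q H} (hξ : IsVacuum q S ξ) (hη : IsVacuum q S η)
    {x : FockSpace q H →L[ℂ] FockSpace q H} (hx : x ∈ relToeplitz q S) :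
    ⟪ξ, x ξ⟫_ℂ * ⟪η, η⟫_ℂ = ⟪η, x η⟫_ℂ * ⟪ξ, ξ⟫_ℂ := by
  -- Cross-multiplying by the squared norms avoids normalising `ξ` and `η`, and leaves an identity
  -- linear and continuous in `x`; it suffices to check Wick ordered products.
  refine closure_minimal (s := ((StarAlgebra.adjoin ℂ (creation q '' (S : Set H)) :
      StarSubalgebra ℂ _) : Set (FockSpace q H →L[ℂ] FockSpace q H)))
    (t := {x | ⟪ξ, x ξ⟫_ℂ * ⟪η, η⟫_ℂ = ⟪η, x η⟫_ℂ * ⟪ξ, ξ⟫_ℂ}) ?_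
    (isClosed_eq (by fun_prop) (by fun_prop)) hx
  intro x hx
  change ⟪ξ, x ξ⟫_ℂ * ⟪η, η⟫_ℂ = ⟪η, x η⟫_ℂ * ⟪ξ, ξ⟫_ℂ
  have hw := adjoin_le_wickSpan q S hx
  clear hx
  induction hw using Submodule.span_induction with
  | mem x hx =>
    obtain ⟨P, hP, R, hR, rfl⟩ := hx
    have h : ∀ ζ, ⟪ζ, (P * star R) ζ⟫_ℂ = ⟪star P ζ, star R ζ⟫_ℂ := fun ζ =>
      (adjoint_inner_left P (star R ζ) ζ).symm
    rw [h, h]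
    -- Only `P = R = 1` can contribute; otherwise one of the two vectors in the pairing vanishes,
    -- for `ξ` and for `η` alike.
    rcases IsVacuum.star_word_apply hP with rfl | hP
    · rcases IsVacuum.star_word_apply hR with rfl | hR
      · rw [star_one]
        exact mul_comm ⟪ξ, ξ⟫_ℂ ⟪η, η⟫_ℂ
      · simp [hR ξ hξ, hR η hη]
    · simp [hP ξ hξ, hP η hη]
  | zero => simp
  | add x y _ _ hx hy => simp only [add_apply, inner_add_right, add_mul, hx, hy]
  | smul c x _ hx => simp only [smul_apply, inner_smul_right, mul_assoc, hx]

/-- The words in creation operators applied to vacuum vectors are total. -/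
theorem eq_zero_of_inner_word_vacuum {q : Set.Ioo (-1 : ℝ) 1} {S : Submodule ℂ H}
    {η : FockSpace q H}
    (h : ∀ P ∈ creationWords q S, ∀ ξ, IsVacuum q S ξ → ⟪P ξ, η⟫_ℂ = 0) : η = 0 := by
  -- The vector is quantified inside the induction because the inductive hypothesis is applied to
  -- `a(v) η` instead of `η`.
  suffices key : ∀ n, ∀ η : FockSpace q H,
      (∀ P ∈ creationWords q S, ∀ ξ, IsVacuum q S ξ → ⟪P ξ, η⟫_ℂ = 0) → η n = 0 by
    ext n
    exact key n η h
  intro n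
  induction n with
  | zero =>
    intro η h
    have hv : IsVacuum q S (lp.single 2 0 (η 0)) := by
      intro v _
      ext m
      change adjoint (creation q v) _ m = 0
      rw [adjoint_creation_apply]
      simp
    exact inner_self_eq_zero.1 ((inner_single_left q _ _ η).symm.trans (h 1 (one_mem _) _ hv))
  | succ n ih =>
    intro η h
    -- Orthogonality passes to `a(v) η`, as `⟪P ξ, a(v) η⟫ = ⟪a*(v) P ξ, η⟫`. By induction its
    -- degree `n` part, which is `a(v)` applied to the degree `n + 1` part of `η`, is zero. So that
    -- part is itself a vacuum vector, and the trivial word makes it orthogonal to `η`, hence to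
    -- itself.
    have hv : IsVacuum q S (lp.single 2 (n + 1) (η (n + 1))) := by
      intro v hv
      ext m
      change adjoint (creation q v) _ m = 0
      rw [adjoint_creation_apply]
      by_cases hm : m = n
      · subst hm
        have h0 := ih (adjoint (creation q v) η) fun P hP ξ hξ => by
          rw [adjoint_inner_right]
          exact h _ (mul_mem (creation_mem_creationWords q hv) hP) ξ hξ
        rw [adjoint_creation_apply] at h0
        simpa using h0
      · simp [hm]
    exact inner_self_eq_zero.1 ((inner_single_left q _ _ η).symm.trans (h 1 (one_mem _) _ hv))

theorem creationWords_le_relToeplitz (q : Set.Ioo (-1 : ℝ) 1) (S : Submodule ℂ H)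
    {P : FockSpace q H →L[ℂ] FockSpace q H} (hP : P ∈ creationWords q S) :
    P ∈ relToeplitz q S := by
  refine StarSubalgebra.le_topologicalClosure _ ?_
  exact (Submonoid.closure_le (S := (StarAlgebra.adjoin ℂ
    (creation q '' (S : Set H))).toSubalgebra.toSubmonoid)).2 (StarAlgebra.subset_adjoin ℂ _) hP

end Wick

/-! ### Injectivity of the compression -/

section Injectivity

open ContinuousLinearMap

variable {H : Type*} [NormedAddCommGroup H] [InnerProductSpace ℂ H]
variable {K : Type*} [NormedAddCommGroup K] [InnerProductSpace ℂ K]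

/-- The empty tensor. -/
noncomputable def algVacuum (q : Set.Ioo (-1 : ℝ) 1) (H : Type*) [NormedAddCommGroup H]
    [InnerProductSpace ℂ H] : AlgTensor q 0 H :=
  PiTensorProduct.tprod ℂ (Fin.elim0 : Fin 0 → H)

/-- The vacuum vector of the `q`-Fock space. -/
noncomputable def vacuum (q : Set.Ioo (-1 : ℝ) 1) (H : Type*) [NormedAddCommGroup H]
    [InnerProductSpace ℂ H] : FockSpace q H :=
  lp.single 2 0 (algVacuum q H : QTensor q 0 H)

theorem inner_vacuum (q : Set.Ioo (-1 : ℝ) 1) : ⟪vacuum q H, vacuum q H⟫_ℂ = 1 := by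
  rw [vacuum, lp.inner_single_left, lp.single_apply_self, UniformSpace.Completion.inner_coe]
  refine (qForm_tprod (q : ℝ) (Fin.elim0 : Fin 0 → H) Fin.elim0).trans ?_
  simp [inversions]

theorem isVacuum_vacuum (q : Set.Ioo (-1 : ℝ) 1) (S : Submodule ℂ H) :
    IsVacuum q S (vacuum q H) := by
  intro v _
  ext m
  change adjoint (creation q v) _ m = 0
  rw [adjoint_creation_apply]
  simp [vacuum]

theorem firstQuantisation_vacuum (q : Set.Ioo (-1 : ℝ) 1) (ι : K →ₗᵢ[ℂ] H) :
    firstQuantisation q ι (vacuum q K) = vacuum q H := by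
  ext n
  rw [firstQuantisation_apply]
  cases n with
  | zero =>
    rw [vacuum, vacuum, lp.single_apply_self, lp.single_apply_self, levelMap_coe]
    congr 1
    refine (PiTensorProduct.map_tprod _ _).trans ?_
    congr 1
    ext i
    exact i.elim0
  | succ n => simp [vacuum]

/-- An element of the relative `q`-Toeplitz algebra that vanishes on all words in creation
operators applied to the vacuum is zero. -/
theorem eq_zero_of_apply_word_vacuum {q : Set.Ioo (-1 : ℝ) 1} {S : Submodule ℂ H}
    {x : FockSpace q H →L[ℂ] FockSpace q H} (hx : x ∈ relToeplitz q S)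
    (h : ∀ P ∈ creationWords q S, x (P (vacuum q H)) = 0) : x = 0 := by
  have hP : ∀ P ∈ creationWords q S, ∀ ξ, IsVacuum q S ξ → x (P ξ) = 0 := by
    intro P hP ξ hξ
    have hxP := mul_mem hx (creationWords_le_relToeplitz q S hP)
    -- The state of a vacuum vector at `(xP)*(xP)` is the squared norm of `x P` on it, so vanishing
    -- at the Fock vacuum forces vanishing at `ξ`.
    have e := hξ.inner_apply_mul (isVacuum_vacuum q S) (mul_mem (star_mem hxP) hxP)
    have hs : ∀ ζ, ⟪ζ, (star (x * P) * (x * P)) ζ⟫_ℂ = ⟪x (P ζ), x (P ζ)⟫_ℂ := fun ζ =>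
      adjoint_inner_right (x * P) ζ (x (P ζ))
    rw [hs, hs, h P hP, inner_vacuum, mul_one, inner_zero_left, zero_mul] at e
    exact inner_self_eq_zero.1 e
  refine ContinuousLinearMap.ext fun η => ext_inner_left ℂ fun ζ => ?_
  -- Totality is applied to `x* ζ`, which is orthogonal to every `P ξ` because `x` kills `P ξ`.
  rw [zero_apply, inner_zero_right, ← adjoint_inner_left,
    eq_zero_of_inner_word_vacuum (q := q) (S := S) (η := adjoint x ζ), inner_zero_left]
  intro P hP' ξ hξ
  rw [adjoint_inner_right, hP P hP' ξ hξ, inner_zero_left]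

theorem toeplitzCompression_injective (q : Set.Ioo (-1 : ℝ) 1) (ι : K →ₗᵢ[ℂ] H) :
    Function.Injective (toeplitzCompression q ι) := by
  refine (injective_iff_map_eq_zero _).2 fun x hx => Subtype.ext ?_
  have hx0 : compression (firstQuantisation q ι) x.1 = 0 := congrArg Subtype.val hx
  have hxF : ∀ ζ, x.1 (firstQuantisation q ι ζ) = 0 := fun ζ => by
    simpa [hx0] using DFunLike.congr_fun (relToeplitz_compression q ι x x.2).2 ζ
  refine eq_zero_of_apply_word_vacuum x.2 fun P hP => ?_
  -- Words in the `a*(ι v)` keep the vacuum inside the range of `F_q(ι)`, where `x` vanishes.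
  have hPF := DFunLike.congr_fun
    (relToeplitz_compression q ι P (creationWords_le_relToeplitz q _ hP)).2 (vacuum q K)
  simp only [comp_apply, firstQuantisation_vacuum] at hPF
  rw [hPF, hxF]

end Injectivity

end QFock

theorem mainTheorem3 (q : Set.Ioo (-1 : ℝ) 1)
    {K : Type*} [NormedAddCommGroup K] [InnerProductSpace ℂ K] [CompleteSpace K]
    {H : Type*} [NormedAddCommGroup H] [InnerProductSpace ℂ H] [CompleteSpace H]
    (ι : K →ₗᵢ[ℂ] H) :
    ∃ Φ : QFock.relToeplitz q (LinearMap.range ι.toLinearMap) →⋆ₐ[ℂ] QFock.toeplitz q K,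
      (∀ x, (Φ x : QFock.FockSpace q K →L[ℂ] QFock.FockSpace q K) =
        (ContinuousLinearMap.adjoint (QFock.firstQuantisation q ι)).comp
          ((x : QFock.FockSpace q H →L[ℂ] QFock.FockSpace q H).comp (QFock.firstQuantisation q ι))) ∧
      Function.Injective Φ :=
  ⟨QFock.toeplitzCompression q ι, fun _ => rfl, QFock.toeplitzCompression_injective q ι⟩
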